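/- Let $V$ be a complex vector space with a basis $\{e_i\}_{i\in\mathbb N}$, let $e^i\in V^*$ be the dual functionals, $e^i(e_j)=\delta_{ij}$, and let $V_*=\operatorname{span}\{e^i\}\subset V^*$. Let $$\mathfrak{gl}^M_\infty=\{\varphi\in\operatorname{End}(V) : \varphi^*(V_*)\subset V_*\}$$ with the commutator bracket. Let $\mathfrak{sl}_\infty$ be the kernel of the pairing $V\otimes V_*\to\mathbb C$, $v\otimes f\mapsto f(v)$, viewed as a Lie subalgebra of $\mathfrak{gl}^M_\infty$ through the embedding $v\otimes f\mapsto (x\mapsto f(x)v)$. Let $\tilde G=\{g\in\operatorname{Aut}(V) : g^*(V_*)=V_*\}$, and let $\tilde G_0\subset\operatorname{Aut}(\mathfrak{gl}^M_\infty)$ be the image of the conjugation action $g\mapsto(\varphi\mapsto g\varphi g^{-1})$ of $\tilde G$. Let $\tau(\varphi)=-\epsilon^{-1}\varphi^*\epsilon$, where $\epsilon:V\to V_*$ is the linear isomorphism with $\epsilon(e_i)=e^i$. If $A$ is the matrix of $\varphi$ in the basis $\{e_i\}$, then the matrix of $\tau(\varphi)$ is $-A^t$. With $\operatorname{Aut}$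 of a Lie algebra denoting its group of $\mathbb C$-linear Lie algebra automorphisms: 1. $\operatorname{Aut}(\mathfrak{gl}^M_\infty)=\tilde G_0\rtimes\{\mathrm{Id},\tau\}$ (internal semidirect product: $\tilde G_0$ is normal, $\{\mathrm{Id},\tau\}$ is a subgroup of order $2$, and every automorphism is uniquely a product of an element of $\tilde G_0$ and an element of $\{\mathrm{Id},\tau\}$). 2. Every automorphism of $\mathfrak{sl}_\infty$ extends uniquely to an automorphism of $\mathfrak{gl}^M_\infty$. -/

import Mathlib

open scoped TensorProduct

noncomputable section

namespace MackeyLie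

attribute [local instance] LieRing.ofAssociativeRing

/-- The Lie algebra automorphisms of `L` form a group under composition. -/
instance lieAutGroup {L : Type*} [LieRing L] [LieAlgebra ℂ L] : Group (L ≃ₗ⁅ℂ⁆ L) where
  mul f g := g.trans f
  one := 1
  inv f := f.symm
  mul_assoc _ _ _ := rfl
  one_mul _ := rfl
  mul_one _ := rfl
  inv_mul_cancel f := by
    apply LieEquiv.ext
    intro x
    exact f.symm_apply_apply x

variable {V : Type*} [AddCommGroup V] [Module ℂ V] (b : Module.Basis ℕ ℂ V)

/-- The space `V_* ⊆ V^*`: the span of the functionals `e^i` dual to the basis `e_i = b i`. -/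
def Vstar : Submodule ℂ (Module.Dual ℂ V) := Submodule.span ℂ (Set.range b.coord)

/-- The Mackey Lie algebra `{φ ∈ End V | φ^*(V_*) ⊆ V_*}`, with the commutator bracket. -/
def glM : LieSubalgebra ℂ (Module.End ℂ V) where
  carrier := {φ | ∀ f ∈ Vstar b, φ.dualMap f ∈ Vstar b}
  add_mem' {φ ψ} hφ hψ f hf := by
    have : (φ + ψ).dualMap f = φ.dualMap f + ψ.dualMap f := by ext v; simp
    rw [this]
    exact add_mem (hφ f hf) (hψ f hf)
  zero_mem' f hf := by
    have : (0 : Module.End ℂ V).dualMap f = 0 := by ext v; simp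
    rw [this]
    exact zero_mem _
  smul_mem' c φ hφ f hf := by
    have : (c • φ).dualMap f = c • φ.dualMap f := by ext v; simp
    rw [this]
    exact Submodule.smul_mem _ _ (hφ f hf)
  lie_mem' {φ ψ} hφ hψ f hf := by
    have : ⁅φ, ψ⁆.dualMap f = ψ.dualMap (φ.dualMap f) - φ.dualMap (ψ.dualMap f) := by
      ext v; simp [Ring.lie_def]
    rw [this]
    exact sub_mem (hψ _ (hφ f hf)) (hφ _ (hψ f hf))

theorem mem_glM {φ : Module.End ℂ V} :
    φ ∈ glM b ↔ ∀ f ∈ Vstar b, φ.dualMap f ∈ Vstar b := Iff.rfl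

/-- The pairing `V ⊗ V_* → ℂ`, `v ⊗ f ↦ f v` (the trace on `gl_∞ = V ⊗ V_*`). -/
def pairing : V ⊗[ℂ] Vstar b →ₗ[ℂ] ℂ :=
  TensorProduct.lift ((Module.Dual.eval ℂ V).compl₂ (Vstar b).subtype)

@[simp] theorem pairing_tmul (v : V) (f : Vstar b) : pairing b (v ⊗ₜ f) = f.1 v := rfl

/-- The embedding `V ⊗ V_* → End V`, `v ⊗ f ↦ (x ↦ f(x) v)`. -/
def toEnd : V ⊗[ℂ] Vstar b →ₗ[ℂ] Module.End ℂ V :=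
  TensorProduct.lift (((LinearMap.smulRightₗ (R := ℂ) (M := V) (M₂ := V)).flip).compl₂
    (Vstar b).subtype)

@[simp] theorem toEnd_tmul (v : V) (f : Vstar b) (x : V) :
    toEnd b (v ⊗ₜ f) x = f.1 x • v := rfl

theorem toEnd_mem (t : V ⊗[ℂ] Vstar b) : toEnd b t ∈ glM b := by
  induction t with
  | zero => simp
  | add s t hs ht => rw [map_add]; exact add_mem hs ht
  | tmul v f =>
    intro h hh
    have : (toEnd b (v ⊗ₜ f)).dualMap h = h v • f.1 := by ext x; simp [mul_comm]
    rw [this]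
    exact Submodule.smul_mem _ _ f.2

/-- For pure tensors the commutator in `End V` is the bracket of `gl_∞ = V ⊗ V_*`. -/
theorem lie_toEnd_tmul (v w : V) (f h : Vstar b) :
    ⁅toEnd b (v ⊗ₜ f), toEnd b (w ⊗ₜ h)⁆ =
      toEnd b (f.1 w • (v ⊗ₜ h) - h.1 v • (w ⊗ₜ f)) := by
  ext x
  simp [Ring.lie_def, smul_smul, mul_comm]

/-- The basis `e^i` of `V_*`. -/
def dualBasis : Module.Basis ℕ ℂ (Vstar b) := Module.Basis.span b.linearIndependent_coord

theorem dualBasis_coe (i : ℕ) : (dualBasis b i).1 = b.coord i :=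
  Module.Basis.coe_span_apply _ i

theorem dualBasis_repr (f : Vstar b) (j : ℕ) : (dualBasis b).repr f j = f.1 (b j) := by
  have : (dualBasis b).coord j = (Module.Dual.eval ℂ V (b j)) ∘ₗ (Vstar b).subtype := by
    refine (dualBasis b).ext fun i => ?_
    simp [dualBasis_coe, Finsupp.single_apply, eq_comm]
  exact LinearMap.congr_fun this f

theorem toEnd_injective : Function.Injective (toEnd b) := by
  rw [← LinearMap.ker_eq_bot, LinearMap.ker_eq_bot']
  intro t ht
  have key : ∀ s : V ⊗[ℂ] Vstar b, ∀ i j,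
      (b.tensorProduct (dualBasis b)).repr s (i, j) = b.repr (toEnd b s (b j)) i := by
    intro s i j
    induction s with
    | zero => simp
    | add s t hs ht => simp [hs, ht]
    | tmul v f => simp [dualBasis_repr]
  apply (b.tensorProduct (dualBasis b)).repr.injective
  ext ⟨i, j⟩
  rw [key, ht]
  simp

theorem exists_lie_toEnd (s t : V ⊗[ℂ] Vstar b) :
    ∃ r, pairing b r = 0 ∧ toEnd b r = ⁅toEnd b s, toEnd b t⁆ := by
  induction s with
  | zero => exact ⟨0, by simp, by simp⟩
  | add s₁ s₂ h₁ h₂ =>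
    obtain ⟨r₁, h₁, e₁⟩ := h₁
    obtain ⟨r₂, h₂, e₂⟩ := h₂
    exact ⟨r₁ + r₂, by simp [h₁, h₂], by simp [e₁, e₂]⟩
  | tmul v f =>
    induction t with
    | zero => exact ⟨0, by simp, by simp⟩
    | add s₁ s₂ h₁ h₂ =>
      obtain ⟨r₁, h₁, e₁⟩ := h₁
      obtain ⟨r₂, h₂, e₂⟩ := h₂
      exact ⟨r₁ + r₂, by simp [h₁, h₂], by simp [e₁, e₂]⟩
    | tmul w h => exact ⟨_, by simp [mul_comm], (lie_toEnd_tmul b v w f h).symm⟩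

/-- `sl_∞`, the kernel of the pairing on `gl_∞ = V ⊗ V_*`, as a subalgebra of the Mackey
Lie algebra through the embedding `V ⊗ V_* → End V`. -/
def slInf : LieSubalgebra ℂ (glM b) where
  carrier := {φ | ∃ t : V ⊗[ℂ] Vstar b, pairing b t = 0 ∧ toEnd b t = φ.1}
  add_mem' := by
    rintro φ ψ ⟨s, hs, es⟩ ⟨t, ht, et⟩
    exact ⟨s + t, by simp [hs, ht], by simp [es, et]⟩
  zero_mem' := ⟨0, by simp, by simp⟩
  smul_mem' := by
    rintro c φ ⟨s, hs, es⟩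
    exact ⟨c • s, by simp [hs], by simp [es]⟩
  lie_mem' := by
    rintro φ ψ ⟨s, hs, es⟩ ⟨t, ht, et⟩
    obtain ⟨r, hr, er⟩ := exists_lie_toEnd b s t
    exact ⟨r, hr, by rw [er, es, et]; rfl⟩

/-- The group `{g ∈ Aut V | g^*(V_*) = V_*}`. -/
def Gtilde : Subgroup (V ≃ₗ[ℂ] V) where
  carrier := {g | (Vstar b).map g.toLinearMap.dualMap = Vstar b}
  mul_mem' {g h} hg hh := by
    have : (g * h).toLinearMap.dualMap = h.toLinearMap.dualMap ∘ₗ g.toLinearMap.dualMap := rfl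
    simp only [Set.mem_ofPred_eq] at *
    rw [this, Submodule.map_comp, hg, hh]
  one_mem' := by
    have : (1 : V ≃ₗ[ℂ] V).toLinearMap.dualMap = LinearMap.id := rfl
    simp only [Set.mem_ofPred_eq]
    rw [this, Submodule.map_id]
  inv_mem' {g} hg := by
    have : g⁻¹.toLinearMap.dualMap ∘ₗ g.toLinearMap.dualMap = LinearMap.id := by
      ext f v
      exact congrArg f (g.apply_symm_apply v)
    simp only [Set.mem_ofPred_eq] at *
    conv_lhs => rw [← hg]
    rw [← Submodule.map_comp, this, Submodule.map_id]

theorem dualMap_mem_of_mem_Gtilde {g : V ≃ₗ[ℂ] V} (hg : g ∈ Gtilde b) {f : Module.Dual ℂ V}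
    (hf : f ∈ Vstar b) : g.toLinearMap.dualMap f ∈ Vstar b := by
  have h : (Vstar b).map g.toLinearMap.dualMap = Vstar b := hg
  rw [← h]
  exact Submodule.mem_map_of_mem hf

theorem conj_mem {g : V ≃ₗ[ℂ] V} (hg : g ∈ Gtilde b) {φ : Module.End ℂ V} (hφ : φ ∈ glM b) :
    g.toLinearMap ∘ₗ φ ∘ₗ g⁻¹.toLinearMap ∈ glM b := fun _ hf =>
  dualMap_mem_of_mem_Gtilde b (inv_mem hg) (hφ _ (dualMap_mem_of_mem_Gtilde b hg hf))

/-- Conjugation `φ ↦ g φ g⁻¹` by `g` in `Gtilde b`, as an automorphism of `glM b`. -/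
def conjAut (g : Gtilde b) : glM b ≃ₗ⁅ℂ⁆ glM b where
  toFun φ := ⟨g.1.toLinearMap ∘ₗ φ.1 ∘ₗ (g.1)⁻¹.toLinearMap, conj_mem b g.2 φ.2⟩
  invFun φ := ⟨(g.1)⁻¹.toLinearMap ∘ₗ φ.1 ∘ₗ g.1.toLinearMap, by
    simpa using conj_mem b (inv_mem g.2) φ.2⟩
  map_add' φ ψ := by apply Subtype.ext; ext v; simp
  map_smul' c φ := by apply Subtype.ext; ext v; simp
  map_lie' {φ ψ} := by
    apply Subtype.ext
    ext v
    simp [Ring.lie_def, LinearEquiv.coe_inv]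
  left_inv φ := by apply Subtype.ext; ext v; simp [LinearEquiv.coe_inv]
  right_inv φ := by apply Subtype.ext; ext v; simp [LinearEquiv.coe_inv]

/-- The conjugation action as a group homomorphism. -/
def rho : Gtilde b →* (glM b ≃ₗ⁅ℂ⁆ glM b) where
  toFun := conjAut b
  map_one' := rfl
  map_mul' _ _ := rfl

/-- The image of the conjugation action. -/
def G0 : Subgroup (glM b ≃ₗ⁅ℂ⁆ glM b) := (rho b).range

/-- The linear isomorphism `ε : V → V_*` with `ε (e_n) = e^n`. -/
def eps : V ≃ₗ[ℂ] Vstar b := b.equiv (dualBasis b) (Equiv.refl ℕ)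

theorem eps_basis (n : ℕ) : (eps b (b n)).1 = b.coord n := by
  simp [eps, dualBasis_coe]

theorem eps_apply_basis (v : V) (i : ℕ) : (eps b v).1 (b i) = b.repr v i := by
  rw [← dualBasis_repr]
  simp [eps, Module.Basis.equiv]

/-- The restriction of `φ^*` to an endomorphism of `V_*`. -/
def dualRestrict (φ : glM b) : Module.End ℂ (Vstar b) := φ.1.dualMap.restrict φ.2

theorem dualRestrict_apply (φ : glM b) (f : Vstar b) (v : V) :
    (dualRestrict b φ f).1 v = f.1 (φ.1 v) := rfl

/-- The endomorphism `-ε⁻¹ φ^* ε` of `V`. -/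
def tauFun (φ : glM b) : Module.End ℂ V :=
  -((eps b).symm.toLinearMap ∘ₗ dualRestrict b φ ∘ₗ (eps b).toLinearMap)

theorem tauFun_entry (φ : glM b) (i j : ℕ) :
    b.repr (tauFun b φ (b j)) i = -b.repr (φ.1 (b i)) j := by
  rw [← eps_apply_basis]
  simp [tauFun, dualRestrict_apply, eps_basis]

theorem tauFun_mem (φ : glM b) : tauFun b φ ∈ glM b := by
  intro f hf
  induction hf using Submodule.span_induction with
  | mem f hf =>
    obtain ⟨i, rfl⟩ := hf
    have : (tauFun b φ).dualMap (b.coord i) = -(eps b (φ.1 (b i))).1 := by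
      refine b.ext fun j => ?_
      simp [tauFun_entry, eps_apply_basis]
    rw [this]
    exact neg_mem (eps b _).2
  | zero => simp
  | add f g _ _ hf hg => rw [map_add]; exact add_mem hf hg
  | smul c f _ hf => rw [map_smul]; exact Submodule.smul_mem _ c hf

theorem tauFun_tauFun (φ : glM b) : tauFun b ⟨tauFun b φ, tauFun_mem b φ⟩ = φ.1 := by
  refine b.ext fun j => b.repr.injective (Finsupp.ext fun i => ?_)
  simp [tauFun_entry]

/-- The involution `φ ↦ -ε⁻¹ φ^* ε` of the Mackey Lie algebra. -/
def tau : glM b ≃ₗ⁅ℂ⁆ glM b where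
  toFun φ := ⟨tauFun b φ, tauFun_mem b φ⟩
  invFun φ := ⟨tauFun b φ, tauFun_mem b φ⟩
  map_add' φ ψ := by
    apply Subtype.ext
    refine b.ext fun j => b.repr.injective (Finsupp.ext fun i => ?_)
    simp [tauFun_entry, add_comm]
  map_smul' c φ := by
    apply Subtype.ext
    refine b.ext fun j => b.repr.injective (Finsupp.ext fun i => ?_)
    simp [tauFun_entry]
  map_lie' {φ ψ} := by
    apply Subtype.ext
    have h : ∀ χ ω : glM b, ∀ v, tauFun b χ (tauFun b ω v) =
        (eps b).symm (dualRestrict b χ (dualRestrict b ω (eps b v))) := by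
      intro χ ω v
      simp [tauFun]
    have h2 : dualRestrict b ⁅φ, ψ⁆ =
        dualRestrict b ψ ∘ₗ dualRestrict b φ - dualRestrict b φ ∘ₗ dualRestrict b ψ := by
      ext f v
      simp [dualRestrict_apply, Ring.lie_def]
    ext v
    simp only [LieSubalgebra.coe_bracket, Ring.lie_def, LinearMap.sub_apply,
      Module.End.mul_apply, h]
    simp [tauFun, h2]
  left_inv φ := Subtype.ext (tauFun_tauFun b φ)
  right_inv φ := Subtype.ext (tauFun_tauFun b φ)

/-- The matrix of an element of `glM b` in the basis `b`: column `j` holds the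
coordinates of `φ (b j)`. -/
def mat (φ : glM b) : Matrix ℕ ℕ ℂ := Matrix.of fun i j => b.repr (φ.1 (b j)) i

end MackeyLie

end

noncomputable section

namespace MackeyLie

attribute [local instance] LieRing.ofAssociativeRing

variable {V : Type*} [AddCommGroup V] [Module ℂ V] (b : Module.Basis ℕ ℂ V)

/-! ### Separation of vectors by functionals in `V_*` -/

/-! Transvections, the maps `v ⊗ f` with `v, f ≠ 0`, `f ∈ V_*` and `f v = 0`, are recognisable from
the bracket alone: they are the noncentral `x` with `[x, [x, y]] ∈ ℂ x` for every `y`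
(`isTransvection_of_extremal`). Hence automorphisms of either algebra preserve them, and those of
the Mackey algebra preserve `sl_∞`, which they generate.

If two transvections have a transvection as their sum, their vectors or their functionals are
proportional. Apply this to the images of `E_{01}` and `E_{02}`: after composing with `τ` if
necessary, the vectors are proportional. Then all `E_{0n}` go to `g ⊗ f_n` and all `E_{n0}` to `z_n
⊗ q`, and double brackets force `q, f_n` to be dual to `g, z_n`. Sending the basis to `g, z_1, z_2,
…` gives an intertwiner `G`, which turns out to lie in `Gtilde` (`exists_intertwiner`,
`exists_conjAut`). So on `sl_∞` every automorphism is a conjugation up to `τ`, and therefore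
extends.

An automorphism fixing `sl_∞` pointwise moves each element by a scalar; scalars disappear in
brackets and every element is a bracket (`exists_lie_unshift`), so it is the identity. Finally `τ`
negates the identity of `V`, which conjugations fix, so `τ ∉ G0` and `G0` has index 2. -/

theorem coord_mem_Vstar (i : ℕ) : b.coord i ∈ Vstar b := Submodule.subset_span ⟨i, rfl⟩

theorem exists_Vstar_apply_eq (f : Module.Dual ℂ V) {n : ℕ} (v : Fin n → V) :
    ∃ h : Vstar b, ∀ i, h.1 (v i) = f (v i) := by
  classical
  let s : Finset ℕ := Finset.univ.biUnion fun i => (b.repr (v i)).support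
  refine ⟨⟨∑ j ∈ s, f (b j) • b.coord j,
    sum_mem fun j _ => Submodule.smul_mem _ _ (coord_mem_Vstar b j)⟩, fun i => ?_⟩
  conv_rhs => rw [← b.linearCombination_repr (v i)]
  rw [Finsupp.linearCombination_apply, Finsupp.sum_of_support_subset (s := s) _ _ _ (by simp)]
  · simp [mul_comm]
  · intro j hj
    exact Finset.mem_biUnion.2 ⟨i, Finset.mem_univ _, hj⟩

theorem exists_dual_apply_eq {n : ℕ} {v : Fin n → V} (hv : LinearIndependent ℂ v)
    (c : Fin n → ℂ) : ∃ h : Module.Dual ℂ V, ∀ i, h (v i) = c i := by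
  obtain ⟨g, hg⟩ := LinearMap.exists_extend ((Module.Basis.span hv).constr ℂ c)
  refine ⟨g, fun i => ?_⟩
  have := LinearMap.congr_fun hg (Module.Basis.span hv i)
  rw [Module.Basis.constr_basis] at this
  rw [← this, LinearMap.comp_apply, Submodule.subtype_apply, Module.Basis.coe_span_apply]

theorem exists_Vstar_of_linearIndependent {n : ℕ} {v : Fin n → V}
    (hv : LinearIndependent ℂ v) (c : Fin n → ℂ) : ∃ h : Vstar b, ∀ i, h.1 (v i) = c i := by
  obtain ⟨f, hf⟩ := exists_dual_apply_eq hv c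
  obtain ⟨h, hh⟩ := exists_Vstar_apply_eq b f v
  exact ⟨h, fun i => (hh i).trans (hf i)⟩

theorem exists_Vstar_pair {v w : V} (h : LinearIndependent ℂ ![v, w]) (p q : ℂ) :
    ∃ f : Vstar b, f.1 v = p ∧ f.1 w = q := by
  obtain ⟨f, hf⟩ := exists_Vstar_of_linearIndependent b h ![p, q]
  exact ⟨f, hf 0, hf 1⟩

theorem exists_Vstar_triple {u v w : V} (h : LinearIndependent ℂ ![u, v, w]) (p q r : ℂ) :
    ∃ f : Vstar b, f.1 u = p ∧ f.1 v = q ∧ f.1 w = r := by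
  obtain ⟨f, hf⟩ := exists_Vstar_of_linearIndependent b h ![p, q, r]
  exact ⟨f, hf 0, hf 1, hf 2⟩

theorem exists_Vstar_one {v : V} (h : v ≠ 0) : ∃ f : Vstar b, f.1 v = 1 := by
  obtain ⟨f, hf⟩ := exists_Vstar_of_linearIndependent b (v := ![v])
    (LinearIndependent.of_subsingleton (0 : Fin 1) (by simpa using h)) ![1]
  exact ⟨f, hf 0⟩

theorem linearIndependent_triple {u v w : V} (h : LinearIndependent ℂ ![v, w])
    (hu : u ∉ Submodule.span ℂ {v, w}) : LinearIndependent ℂ ![u, v, w] := by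
  rw [linearIndependent_finSucc]
  have e : Fin.tail ![u, v, w] = ![v, w] := rfl
  rw [e, Matrix.range_cons_cons_empty]
  exact ⟨h, hu⟩

theorem exists_notMem_span_pair (b : Module.Basis ℕ ℂ V) (v w : V) : ∃ u, u ∉ Submodule.span ℂ {v, w} := by
  by_contra! h
  have : Module.Finite ℂ V := Module.Finite.of_fg_top <| by
    rw [← Submodule.eq_top_iff'.2 h]
    exact Submodule.fg_span (Set.toFinite _)
  exact not_finite_iff_infinite.2 (inferInstanceAs (Infinite ℕ)) (Module.Finite.finite_basis b)

theorem exists_linearIndependent_pair {φ : Module.End ℂ V} (h : ∀ c : ℂ, φ ≠ c • LinearMap.id) :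
    ∃ w, LinearIndependent ℂ ![w, φ w] := by
  by_contra! H
  obtain ⟨c, hc⟩ := φ.exists_eq_smul_id_of_forall_notLinearIndependent H
  exact h c hc

/-! ### Extremal elements -/

/-- A square-zero endomorphism of the form `v ⊗ f` with `f ∈ V_*`. -/
def IsTransvection (φ : Module.End ℂ V) : Prop :=
  ∃ v : V, ∃ f : Vstar b, v ≠ 0 ∧ f ≠ 0 ∧ f.1 v = 0 ∧ φ = toEnd b (v ⊗ₜ f)

theorem lie_lie_apply (φ ψ : Module.End ℂ V) (u : V) :
    ⁅φ, ⁅φ, ψ⁆⁆ u = φ (φ (ψ u)) - (2 : ℂ) • φ (ψ (φ u)) + ψ (φ (φ u)) := by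
  simp [Ring.lie_def, two_smul]
  abel

/-- An extremal element is scalar or a transvection. -/
theorem isTransvection_of_extremal {φ : Module.End ℂ V} (hφ : φ ∈ glM b)
    (hs : ∀ c : ℂ, φ ≠ c • LinearMap.id)
    (h : ∀ w : V, ∀ f : Vstar b, f.1 w = 0 →
      ∃ c : ℂ, ⁅φ, ⁅φ, toEnd b (w ⊗ₜ f)⁆⁆ = c • φ) : IsTransvection b φ := by
  obtain ⟨w, hw⟩ := exists_linearIndependent_pair hs
  have hind : ∀ p q : ℂ, p • w + q • φ w = 0 → p = 0 ∧ q = 0 :=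
    LinearIndependent.pair_iff.1 hw
  -- Test the hypothesis on `w ⊗ f`. Evaluating at `w` and comparing coefficients of `w` and `φ w`
  -- gives `f (φ² w) = 0` and `c = -2`.
  have key : ∀ f : Vstar b, f.1 w = 0 → f.1 (φ w) = 1 → f.1 (φ (φ w)) = 0 ∧
      ∀ v, f.1 v • φ (φ w) - (2 * f.1 (φ v)) • φ w + f.1 (φ (φ v)) • w = (-2 : ℂ) • φ v := by
    intro f h0 h1
    obtain ⟨c, hc⟩ := h w f h0
    have hv : ∀ v, f.1 v • φ (φ w) - (2 * f.1 (φ v)) • φ w + f.1 (φ (φ v)) • w = c • φ v := by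
      intro v
      have := LinearMap.congr_fun hc v
      rw [lie_lie_apply] at this
      simpa [smul_smul] using this
    have h2 := hv w
    rw [h0, h1] at h2
    obtain ⟨h3, h4⟩ := hind (f.1 (φ (φ w))) (-2 - c) (by
      rw [← sub_eq_zero] at h2
      rw [← h2]
      module)
    have hc2 : c = -2 := by linear_combination -h4
    exact ⟨h3, fun v => hc2 ▸ hv v⟩
  obtain ⟨a, ha⟩ : ∃ a : ℂ, φ (φ w) = a • w := by
    by_cases hm : φ (φ w) ∈ Submodule.span ℂ {w, φ w}
    · obtain ⟨a, q, haq⟩ := Submodule.mem_span_pair.1 hm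
      obtain ⟨f, h0, h1⟩ := exists_Vstar_pair b hw 0 1
      have h2 := (key f h0 h1).1
      rw [← haq] at h2
      have hq : q = 0 := by simpa [h0, h1] using h2
      exact ⟨a, by rw [← haq, hq]; simp⟩
    · obtain ⟨f, h2, h0, h1⟩ := exists_Vstar_triple b (linearIndependent_triple hw hm) 1 0 1
      exact absurd (h2.symm.trans (key f h0 h1).1) one_ne_zero
  have key2 : ∀ f : Vstar b, f.1 w = 0 → f.1 (φ w) = 1 → ∀ v,
      φ v = (-(a * f.1 v) / 3) • w + f.1 (φ v) • φ w := by
    intro f h0 h1 v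
    have h2 := (key f h0 h1).2 v
    have h3 : φ v = (-(a * f.1 v + f.1 (φ (φ v))) / 2) • w + f.1 (φ v) • φ w := by
      have : φ v = (-1 / 2 : ℂ) • ((-2 : ℂ) • φ v) := by module
      refine this.trans ?_
      rw [← h2, ha]
      module
    -- Applying `f ∘ φ` to `h3` gives a linear equation for `f (φ² v)`; its solution is the source
    -- of the 3.
    have h4 : f.1 (φ (φ v)) = -(a * f.1 v + f.1 (φ (φ v))) / 2 := by
      conv_lhs => rw [h3]
      simp [ha, h0, h1]
    have h5 : f.1 (φ (φ v)) = -(a * f.1 v) / 3 := by linear_combination (2 / 3 : ℂ) * h4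
    rw [← h4, h5] at h3
    exact h3
  -- Two admissible functionals that differ only at `u` give two formulas for `φ u`; their
  -- `w`-coefficients are `0` and `-a/3`, so `a = 0`. What remains of `key2` is `φ = φ w ⊗ (f ∘ φ)`.
  obtain ⟨u, hu⟩ := exists_notMem_span_pair b w (φ w)
  have h3 := linearIndependent_triple hw hu
  obtain ⟨f, hu0, h0, h1⟩ := exists_Vstar_triple b h3 0 0 1
  obtain ⟨f', hu1, h0', h1'⟩ := exists_Vstar_triple b h3 1 0 1
  have ha0 : a = 0 := by
    have e := key2 f h0 h1 u
    have e' := e.symm.trans (key2 f' h0' h1' u)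
    rw [hu0, hu1, ← sub_eq_zero] at e'
    have := (hind (a / 3) (f.1 (φ u) - f'.1 (φ u)) (by rw [← e']; module)).1
    linear_combination (3 : ℂ) * this
  refine ⟨φ w, ⟨φ.dualMap f.1, hφ _ f.2⟩, ?_, ?_, ?_, ?_⟩
  · intro h
    rw [h, map_zero] at h1
    exact zero_ne_one h1
  · intro h
    have : f.1 (φ w) = 0 := LinearMap.congr_fun (congrArg Subtype.val h) w
    exact zero_ne_one (this.symm.trans h1)
  · simp [ha, h0]
  · ext v
    rw [toEnd_tmul, key2 f h0 h1 v, ha0]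
    simp

/-- The elements commuting with `sl_∞` are scalar. -/
theorem exists_eq_smul_id_of_commute {φ : Module.End ℂ V}
    (h : ∀ w : V, ∀ f : Vstar b, f.1 w = 0 → ⁅φ, toEnd b (w ⊗ₜ f)⁆ = 0) :
    ∃ c : ℂ, φ = c • LinearMap.id := by
  by_contra! hs
  obtain ⟨w, hw⟩ := exists_linearIndependent_pair hs
  obtain ⟨f, h0, h1⟩ := exists_Vstar_pair b hw 0 1
  have h2 := LinearMap.congr_fun (h w f h0) (φ w)
  have h3 : φ w - f.1 (φ (φ w)) • w = 0 := by simpa [Ring.lie_def, h1] using h2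
  have := LinearIndependent.pair_iff.1 hw (-f.1 (φ (φ w))) 1 (by rw [← h3]; module)
  exact one_ne_zero this.2

/-! ### Elements of `sl_∞` -/

/-- The projection of `V ⊗ V_*` onto `sl_∞` along the line of `e_0 ⊗ e^0`. -/
def toSl : V ⊗[ℂ] Vstar b →ₗ[ℂ] slInf b where
  toFun t := ⟨⟨toEnd b (t - pairing b t • (b 0 ⊗ₜ dualBasis b 0)), toEnd_mem b _⟩,
    t - pairing b t • (b 0 ⊗ₜ dualBasis b 0), by simp [dualBasis_coe], rfl⟩
  map_add' s t := by
    apply Subtype.ext; apply Subtype.ext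
    change toEnd b _ = toEnd b _ + toEnd b _
    rw [← map_add, map_add (pairing b)]
    congr 1
    module
  map_smul' c t := by
    apply Subtype.ext; apply Subtype.ext
    change toEnd b _ = c • toEnd b _
    rw [← map_smul (toEnd b), map_smul (pairing b), smul_eq_mul]
    congr 1
    module

theorem toSl_coe (t : V ⊗[ℂ] Vstar b) :
    ((toSl b t : glM b) : Module.End ℂ V) =
      toEnd b (t - pairing b t • (b 0 ⊗ₜ dualBasis b 0)) := rfl

theorem toSl_coe_of_pairing {t : V ⊗[ℂ] Vstar b} (h : pairing b t = 0) :
    ((toSl b t : glM b) : Module.End ℂ V) = toEnd b t := by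
  rw [toSl_coe, h, zero_smul, sub_zero]

theorem toSl_surjective : Function.Surjective (toSl b) := by
  rintro ⟨⟨φ, hφ⟩, t, ht, e⟩
  exact ⟨t, Subtype.ext (Subtype.ext ((toSl_coe_of_pairing b ht).trans e))⟩

theorem dualBasis_apply (i j : ℕ) : (dualBasis b i).1 (b j) = if j = i then 1 else 0 := by
  simp [dualBasis_coe, Finsupp.single_apply]

/-- `sl_∞` is generated by the matrix units `E_{0n}` and `E_{n0}`, `n ≥ 1`. -/
theorem slInf_subalgebra_eq_top (S : LieSubalgebra ℂ (slInf b))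
    (hx : ∀ n, toSl b (b 0 ⊗ₜ dualBasis b (n + 1)) ∈ S)
    (hy : ∀ n, toSl b (b (n + 1) ⊗ₜ dualBasis b 0) ∈ S) : ∀ x, x ∈ S := by
  suffices h : S.toSubmodule.comap (toSl b) = ⊤ by
    intro x
    obtain ⟨t, rfl⟩ := toSl_surjective b x
    exact (Submodule.eq_top_iff'.1 h) t
  rw [eq_top_iff, ← (b.tensorProduct (dualBasis b)).span_eq, Submodule.span_le]
  rintro _ ⟨⟨i, j⟩, rfl⟩
  rw [Module.Basis.tensorProduct_apply]
  change toSl b _ ∈ S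
  rcases i with _ | i <;> rcases j with _ | j
  · convert S.zero_mem
    apply Subtype.ext; apply Subtype.ext
    rw [toSl_coe]
    simp [dualBasis_apply]
  · exact hx j
  · exact hy i
  -- `[E_{i+1,0}, E_{0,j+1}] = E_{i+1,j+1} - δ_{ij} E_{00}`, exactly the projection of
  -- `E_{i+1,j+1}`.
  · convert S.lie_mem (hy i) (hx j)
    apply Subtype.ext; apply Subtype.ext
    rw [LieSubalgebra.coe_bracket, LieSubalgebra.coe_bracket, toSl_coe,
      toSl_coe_of_pairing b (by simp [dualBasis_apply]),
      toSl_coe_of_pairing b (by simp [dualBasis_apply]), lie_toEnd_tmul]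
    congr 1
    simp [dualBasis_apply]

/-- `[φ, v ⊗ f] = φ v ⊗ f - v ⊗ φ^* f`, and both terms pair to `f (φ v)`. -/
theorem lie_mem_slInf (φ : glM b) (x : slInf b) : ⁅φ, (x : glM b)⁆ ∈ slInf b := by
  obtain ⟨t, -, ht⟩ := x.2
  suffices h : ∃ r, pairing b r = 0 ∧ toEnd b r = ⁅φ.1, toEnd b t⁆ by
    obtain ⟨r, hr, e⟩ := h
    exact ⟨r, hr, by rw [e, ht]; rfl⟩
  clear ht
  induction t with
  | zero => exact ⟨0, by simp, by simp⟩
  | add s₁ s₂ h₁ h₂ =>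
    obtain ⟨r₁, h₁, e₁⟩ := h₁
    obtain ⟨r₂, h₂, e₂⟩ := h₂
    exact ⟨r₁ + r₂, by simp [h₁, h₂], by simp [e₁, e₂]⟩
  | tmul v f =>
    refine ⟨φ.1 v ⊗ₜ f - v ⊗ₜ dualRestrict b φ f, ?_, ?_⟩
    · simp [dualRestrict_apply]
    · ext x
      simp [Ring.lie_def, dualRestrict_apply]

/-! ### Transvections are preserved -/

theorem coe_lie (φ ψ : glM b) : (⁅φ, ψ⁆ : glM b).1 = ⁅φ.1, ψ.1⁆ := rfl

theorem toEnd_ne_smul_id {v : V} {f : Vstar b} (hv : v ≠ 0) (hf : f ≠ 0) (h : f.1 v = 0)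
    (c : ℂ) : toEnd b (v ⊗ₜ f) ≠ c • LinearMap.id := by
  intro e
  have h1 : c • v = 0 := by simpa [h, eq_comm] using LinearMap.congr_fun e v
  have hc : c = 0 := (smul_eq_zero.1 h1).resolve_right hv
  refine hf (Subtype.ext (LinearMap.ext fun u => ?_))
  have h2 : f.1 u • v = 0 := by simpa [hc] using LinearMap.congr_fun e u
  exact (smul_eq_zero.1 h2).resolve_right hv

/-- Being noncentral and extremal is intrinsic to `L`, so it can be read through either embedding.
The two embeddings allow `L` to be the Mackey algebra or `sl_∞`. -/
theorem IsTransvection.map {L : Type*} [LieRing L] [LieAlgebra ℂ L] {ι κ : L →ₗ⁅ℂ⁆ glM b}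
    (hι : Function.Injective ι) (hκ : Function.Injective κ)
    (sι : ∀ x : slInf b, ∃ y, ι y = x) (sκ : ∀ x : slInf b, ∃ y, κ y = x) {x : L}
    (hx : IsTransvection b (ι x).1) : IsTransvection b (κ x).1 := by
  obtain ⟨v, f, hv, hf, hfv, e⟩ := hx
  have hext : ∀ y, ∃ c : ℂ, ⁅x, ⁅x, y⁆⁆ = c • x := by
    intro y
    -- For `x = v ⊗ f` with `x² = 0`, `[x, [x, y]] = -2 x y x = -2 f(y v) x`.
    refine ⟨-2 * f.1 ((ι y).1 v), hι (Subtype.ext (LinearMap.ext fun u => ?_))⟩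
    rw [LieHom.map_lie, LieHom.map_lie, coe_lie, coe_lie, lie_lie_apply, _root_.map_smul]
    change _ = (-2 * f.1 ((ι y).1 v)) • (ι x).1 u
    rw [e]
    simp only [toEnd_tmul, map_smul, hfv]
    module
  refine isTransvection_of_extremal b (κ x).2 ?_ ?_
  · intro c hc
    obtain ⟨d, hd⟩ := exists_eq_smul_id_of_commute b (φ := (ι x).1) fun w h hw => by
      obtain ⟨y, hy⟩ := sι (toSl b (w ⊗ₜ h))
      rw [← toSl_coe_of_pairing b (t := w ⊗ₜ h) hw, ← hy, ← coe_lie, ← LieHom.map_lie]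
      have : ⁅x, y⁆ = 0 := hκ <| Subtype.ext <| LinearMap.ext fun u => by
        rw [LieHom.map_lie, coe_lie, hc]
        simp [Ring.lie_def]
      rw [this]
      simp
    exact toEnd_ne_smul_id b hv hf hfv d (e ▸ hd)
  · intro w h hw
    obtain ⟨y, hy⟩ := sκ (toSl b (w ⊗ₜ h))
    obtain ⟨c, hc⟩ := hext y
    refine ⟨c, ?_⟩
    rw [← toSl_coe_of_pairing b (t := w ⊗ₜ h) hw, ← hy, ← coe_lie, ← coe_lie, ← LieHom.map_lie,
      ← LieHom.map_lie, hc, _root_.map_smul]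
    rfl

theorem IsTransvection.mem_slInf {φ : glM b} (h : IsTransvection b φ.1) : φ ∈ slInf b := by
  obtain ⟨v, f, -, -, hfv, e⟩ := h
  exact ⟨v ⊗ₜ f, hfv, e.symm⟩

theorem isTransvection_toSl {v : V} {f : Vstar b} (hv : v ≠ 0) (hf : f ≠ 0) (h : f.1 v = 0) :
    IsTransvection b (toSl b (v ⊗ₜ f) : glM b).1 :=
  ⟨v, f, hv, hf, h, toSl_coe_of_pairing b h⟩

theorem isTransvection_matrixUnit {i j : ℕ} (h : i ≠ j) :
    IsTransvection b (toSl b (b i ⊗ₜ dualBasis b j) : glM b).1 :=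
  isTransvection_toSl b (b.ne_zero i) ((dualBasis b).ne_zero j) (by simp [dualBasis_apply, h])

/-- Automorphisms of the Mackey Lie algebra preserve `sl_∞`. -/
theorem aut_mem_slInf (Φ : glM b ≃ₗ⁅ℂ⁆ glM b) (x : slInf b) : Φ x ∈ slInf b := by
  have hΦ : ∀ φ : glM b, IsTransvection b φ.1 → Φ φ ∈ slInf b := fun φ h =>
    IsTransvection.mem_slInf b <| IsTransvection.map b (ι := LieHom.id) (κ := Φ.toLieHom)
      Function.injective_id Φ.injective (fun x => ⟨x, rfl⟩)
      (fun x => ⟨Φ.symm x, Φ.apply_symm_apply _⟩) h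
  refine slInf_subalgebra_eq_top b ((slInf b).comap (Φ.toLieHom.comp (slInf b).incl))
    (fun n => hΦ _ ?_) (fun n => hΦ _ ?_) x
  · exact isTransvection_matrixUnit b (by omega)
  · exact isTransvection_matrixUnit b (by omega)

theorem aut_surjOn_slInf (Φ : glM b ≃ₗ⁅ℂ⁆ glM b) (x : slInf b) : ∃ y : slInf b, Φ y = x :=
  ⟨⟨Φ.symm x, aut_mem_slInf b Φ.symm x⟩, Φ.apply_symm_apply _⟩

/-! ### The Mackey Lie algebra is perfect -/

/-- The right shift `e_n ↦ e_{n+1}`. -/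
def shift : Module.End ℂ V := b.constr ℂ fun n => b (n + 1)

/-- The left shift `e_{n+1} ↦ e_n`, `e_0 ↦ 0`. -/
def unshift : Module.End ℂ V := b.constr ℂ fun n => Nat.casesOn n 0 b

theorem unshift_zero : unshift b (b 0) = 0 := by simp [unshift]

theorem unshift_succ (n : ℕ) : unshift b (b (n + 1)) = b n := by simp [unshift]

theorem unshift_shift (v : V) : unshift b (shift b v) = v := by
  have : unshift b ∘ₗ shift b = LinearMap.id := b.ext fun n => by
    simp [shift, unshift_succ]
  exact LinearMap.congr_fun this v

theorem mem_glM_of_coord {φ : Module.End ℂ V} (h : ∀ i, φ.dualMap (b.coord i) ∈ Vstar b) :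
    φ ∈ glM b := by
  have : Vstar b ≤ (Vstar b).comap φ.dualMap := Submodule.span_le.2 (by
    rintro _ ⟨i, rfl⟩
    exact h i)
  exact this

theorem coord_unshift (i : ℕ) (v : V) : b.coord i (unshift b v) = b.coord (i + 1) v := by
  have : b.coord i ∘ₗ unshift b = b.coord (i + 1) := b.ext fun n => by
    rcases n with _ | n
    · simp [unshift_zero]
    · simp [unshift_succ, Finsupp.single_apply]
  exact LinearMap.congr_fun this v

theorem coord_zero_shift (v : V) : b.coord 0 (shift b v) = 0 := by
  have : b.coord 0 ∘ₗ shift b = 0 := b.ext fun n => by simp [shift]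
  exact LinearMap.congr_fun this v

theorem unshift_mem : unshift b ∈ glM b := mem_glM_of_coord b fun i => by
  convert coord_mem_Vstar b (i + 1)
  ext v
  exact coord_unshift b i v

/-- The images of the basis vectors under a solution `X` of `[unshift, X] = φ`. -/
def antiderivVec (φ : Module.End ℂ V) : ℕ → V
  | 0 => shift b (φ (b 0))
  | n + 1 => shift b (antiderivVec φ n + φ (b (n + 1)))

/-- The equation `unshift ∘ X = X ∘ unshift + φ` is solved column by column, with `shift` as right
inverse of `unshift`; this makes row 0 of `X` vanish. -/
theorem exists_lie_unshift (φ : glM b) :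
    ∃ ψ : glM b, ⁅(⟨unshift b, unshift_mem b⟩ : glM b), ψ⁆ = φ := by
  let X : Module.End ℂ V := b.constr ℂ (antiderivVec b φ.1)
  have hX : ∀ v, unshift b (X v) = X (unshift b v) + φ.1 v := by
    have : unshift b ∘ₗ X = X ∘ₗ unshift b + φ.1 := b.ext fun n => by
      rcases n with _ | n
      · simp [X, antiderivVec, unshift_zero, unshift_shift]
      · simp [X, antiderivVec, unshift_succ, unshift_shift]
    exact LinearMap.congr_fun this
  have h0 : ∀ v, b.coord 0 (X v) = 0 := by
    have : b.coord 0 ∘ₗ X = 0 := b.ext fun n => by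
      rcases n with _ | n
      · simpa [X, antiderivVec] using coord_zero_shift b _
      · simpa [X, antiderivVec] using coord_zero_shift b (antiderivVec b φ.1 n + φ.1 (b (n + 1)))
    exact LinearMap.congr_fun this
  -- Row `i + 1` of `X` is row `i` moved one place to the right plus row `i` of `φ`, so finiteness
  -- of the rows propagates from row 0.
  have hmem : X ∈ glM b := mem_glM_of_coord b fun i => by
    induction i with
    | zero =>
      have : X.dualMap (b.coord 0) = 0 := LinearMap.ext h0
      rw [this]
      exact zero_mem _
    | succ i ih =>
      have : X.dualMap (b.coord (i + 1)) =
          (unshift b).dualMap (X.dualMap (b.coord i)) + φ.1.dualMap (b.coord i) := by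
        ext v
        change b.coord (i + 1) (X v) = b.coord i (X (unshift b v)) + b.coord i (φ.1 v)
        rw [← coord_unshift, hX, map_add]
      rw [this]
      exact add_mem (unshift_mem b _ ih) (φ.2 _ (coord_mem_Vstar b i))
  refine ⟨⟨X, hmem⟩, Subtype.ext (LinearMap.ext fun v => ?_)⟩
  rw [coe_lie]
  simp [Ring.lie_def, hX]

/-! ### Uniqueness of extensions -/

/-- For `x ∈ sl_∞`, `Θ` fixes both `x` and `[ψ, x]`, so `Θ ψ - ψ` commutes with `sl_∞` and is
scalar. Writing `φ` as a bracket removes the scalars. -/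
theorem aut_eq_refl_of_fix (Θ : glM b ≃ₗ⁅ℂ⁆ glM b) (h : ∀ x : slInf b, Θ x = x) (φ : glM b) :
    Θ φ = φ := by
  have hc : ∀ ψ : glM b, ∃ c : ℂ, (Θ ψ).1 = ψ.1 + c • LinearMap.id := by
    intro ψ
    obtain ⟨c, hc⟩ := exists_eq_smul_id_of_commute b (φ := (Θ ψ - ψ).1) fun w f hw => by
      have h1 : Θ ⁅ψ, (toSl b (w ⊗ₜ f) : glM b)⁆ = ⁅ψ, (toSl b (w ⊗ₜ f) : glM b)⁆ :=
        h ⟨_, lie_mem_slInf b ψ (toSl b (w ⊗ₜ f))⟩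
      rw [LieEquiv.map_lie, h, ← sub_eq_zero, ← sub_lie] at h1
      rw [← toSl_coe_of_pairing b (t := w ⊗ₜ f) hw, ← coe_lie, h1]
      rfl
    refine ⟨c, ?_⟩
    rw [← hc]
    simp
  obtain ⟨ψ, hψ⟩ := exists_lie_unshift b φ
  obtain ⟨c, hT⟩ := hc ⟨unshift b, unshift_mem b⟩
  obtain ⟨d, hX⟩ := hc ψ
  rw [← hψ, LieEquiv.map_lie]
  apply Subtype.ext
  rw [coe_lie, coe_lie, hT, hX]
  ext v
  simp [Ring.lie_def, smul_smul, mul_comm c d]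
  abel

theorem aut_ext {Φ Ψ : glM b ≃ₗ⁅ℂ⁆ glM b} (h : ∀ x : slInf b, Φ x = Ψ x) : Φ = Ψ := by
  refine LieEquiv.ext fun φ => ?_
  have h1 := aut_eq_refl_of_fix b (Ψ⁻¹ * Φ) (fun x => by
    change Ψ.symm (Φ x) = x
    rw [h, LieEquiv.symm_apply_apply]) φ
  change Ψ.symm (Φ φ) = φ at h1
  rw [← h1, LieEquiv.apply_symm_apply, h1]

/-! ### Embeddings of `sl_∞` -/

/-- The sum has rank one. If `v, w` are independent, functionals dual to them read off `f` and `h`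
as multiples of the single functional of the sum. -/
theorem eq_smul_or_of_add_isTransvection {v w : V} {f h : Vstar b} (hv : v ≠ 0) (hf : f ≠ 0)
    (H : IsTransvection b (toEnd b (v ⊗ₜ f) + toEnd b (w ⊗ₜ h))) :
    (∃ c : ℂ, w = c • v) ∨ ∃ c : ℂ, h = c • f := by
  by_cases hvw : LinearIndependent ℂ ![v, w]
  · right
    obtain ⟨u, k, -, -, -, e⟩ := H
    have e' : ∀ x, f.1 x • v + h.1 x • w = k.1 x • u := LinearMap.congr_fun e
    obtain ⟨p, hp, hp'⟩ := exists_Vstar_pair b hvw 1 0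
    obtain ⟨q, hq, hq'⟩ := exists_Vstar_pair b hvw 0 1
    have h1 : ∀ x, f.1 x = k.1 x * p.1 u := fun x => by
      simpa [hp, hp'] using congrArg p.1 (e' x)
    have h2 : ∀ x, h.1 x = k.1 x * q.1 u := fun x => by
      simpa [hq, hq'] using congrArg q.1 (e' x)
    have hpu : p.1 u ≠ 0 := fun h0 => hf <| Subtype.ext <| LinearMap.ext fun x => by
      simp [h1, h0]
    refine ⟨q.1 u / p.1 u, Subtype.ext (LinearMap.ext fun x => ?_)⟩
    change h.1 x = q.1 u / p.1 u * f.1 x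
    rw [h1, h2]
    field_simp
  · left
    rw [LinearIndependent.pair_iff' hv] at hvw
    push Not at hvw
    obtain ⟨c, hc⟩ := hvw
    exact ⟨c, hc.symm⟩

theorem IsTransvection.apply_apply {φ : Module.End ℂ V} (h : IsTransvection b φ) (u : V) :
    φ (φ u) = 0 := by
  obtain ⟨v, f, -, -, hfv, rfl⟩ := h
  simp [hfv]

theorem IsTransvection.ne_zero {φ : Module.End ℂ V} (h : IsTransvection b φ) : φ ≠ 0 := by
  obtain ⟨v, f, hv, hf, hfv, rfl⟩ := h
  simpa using toEnd_ne_smul_id b hv hf hfv 0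

theorem IsTransvection.of_toEnd {v : V} {f : Vstar b} (h : IsTransvection b (toEnd b (v ⊗ₜ f))) :
    v ≠ 0 ∧ f ≠ 0 ∧ f.1 v = 0 := by
  have h0 := h.ne_zero
  have hv : v ≠ 0 := by
    rintro rfl
    simp at h0
  have hf : f ≠ 0 := by
    rintro rfl
    simp at h0
  refine ⟨hv, hf, ?_⟩
  by_contra hc
  have := h.apply_apply b v
  simp [hc, hv] at this

/-- The matrix unit `E_{0,n+1}`. -/
def rowUnit (n : ℕ) : slInf b := toSl b (b 0 ⊗ₜ dualBasis b (n + 1))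

/-- The matrix unit `E_{n+1,0}`. -/
def colUnit (n : ℕ) : slInf b := toSl b (b (n + 1) ⊗ₜ dualBasis b 0)

theorem rowUnit_coe (n : ℕ) : (rowUnit b n : glM b).1 = toEnd b (b 0 ⊗ₜ dualBasis b (n + 1)) :=
  toSl_coe_of_pairing b (by simp [dualBasis_apply])

theorem colUnit_coe (n : ℕ) : (colUnit b n : glM b).1 = toEnd b (b (n + 1) ⊗ₜ dualBasis b 0) :=
  toSl_coe_of_pairing b (by simp [dualBasis_apply])

theorem isTransvection_rowUnit (n : ℕ) : IsTransvection b (rowUnit b n : glM b).1 :=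
  isTransvection_matrixUnit b (by omega)

theorem isTransvection_colUnit (n : ℕ) : IsTransvection b (colUnit b n : glM b).1 :=
  isTransvection_matrixUnit b (by omega)

theorem isTransvection_rowUnit_add {n m : ℕ} (h : n ≠ m) :
    IsTransvection b (rowUnit b n + rowUnit b m : slInf b).1.1 := by
  have : rowUnit b n + rowUnit b m =
      toSl b (b 0 ⊗ₜ (dualBasis b (n + 1) + dualBasis b (m + 1))) := by
    rw [TensorProduct.tmul_add, map_add]
    rfl
  rw [this]
  refine isTransvection_toSl b (b.ne_zero 0) (fun h0 => ?_) (by simp [dualBasis_apply])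
  have := LinearMap.congr_fun (congrArg Subtype.val h0) (b (n + 1))
  simp [dualBasis_apply, h] at this

theorem isTransvection_colUnit_add {n m : ℕ} (h : n ≠ m) :
    IsTransvection b (colUnit b n + colUnit b m : slInf b).1.1 := by
  have : colUnit b n + colUnit b m =
      toSl b ((b (n + 1) + b (m + 1)) ⊗ₜ dualBasis b 0) := by
    rw [TensorProduct.add_tmul, map_add]
    rfl
  rw [this]
  refine isTransvection_toSl b (fun h0 => ?_) ((dualBasis b).ne_zero 0) (by simp [dualBasis_apply])
  have := congrArg (b.coord (n + 1)) h0
  simp [h.symm] at this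

theorem rowUnit_one_ne_smul (c : ℂ) : rowUnit b 1 ≠ c • rowUnit b 0 := by
  intro h
  have := congrArg (fun x : slInf b => b.coord 0 (x.1.1 (b 2))) h
  change b.coord 0 ((rowUnit b 1).1.1 (b 2)) = b.coord 0 (c • (rowUnit b 0).1.1 (b 2)) at this
  rw [rowUnit_coe, rowUnit_coe] at this
  simp [dualBasis_apply] at this

/-- Encodes the duality of `e^{n+1}` and `e_{m+1}` by brackets alone, so that any embedding
transports it. -/
theorem lie_lie_rowUnit_colUnit (n m : ℕ) :
    ⁅rowUnit b n, ⁅rowUnit b n, colUnit b m⁆⁆ =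
      (if n = m then (-2 : ℂ) else 0) • rowUnit b n := by
  apply Subtype.ext
  apply Subtype.ext
  ext v
  change ⁅(rowUnit b n).1.1, ⁅(rowUnit b n).1.1, (colUnit b m).1.1⁆⁆ v =
    (if n = m then (-2 : ℂ) else 0) • (rowUnit b n).1.1 v
  rw [lie_lie_apply, rowUnit_coe, colUnit_coe]
  by_cases h : n = m
  · simp [dualBasis_apply, h]
  · simp [dualBasis_apply, h, Ne.symm h]

variable {κ : slInf b →ₗ⁅ℂ⁆ glM b} (hinj : Function.Injective κ)
  (ht : ∀ x : slInf b, IsTransvection b x.1.1 → IsTransvection b (κ x).1)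

include hinj ht in
-- Otherwise the functional of the `n`-th image would be proportional to both `f₀` and `f₁`, making
-- the images of `E_{01}` and `E_{02}` proportional, against injectivity.
theorem exists_rowUnit_image {g : V} {f₀ f₁ : Vstar b}
    (h₀ : (κ (rowUnit b 0)).1 = toEnd b (g ⊗ₜ f₀)) (h₁ : (κ (rowUnit b 1)).1 = toEnd b (g ⊗ₜ f₁))
    (n : ℕ) : ∃ f : Vstar b, (κ (rowUnit b n)).1 = toEnd b (g ⊗ₜ f) := by
  rcases eq_or_ne n 0 with rfl | n0
  · exact ⟨_, h₀⟩
  rcases eq_or_ne n 1 with rfl | n1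
  · exact ⟨_, h₁⟩
  obtain ⟨w, h, hw, hh, -, e⟩ := ht _ (isTransvection_rowUnit b n)
  obtain ⟨hg, hf₀, -⟩ := IsTransvection.of_toEnd b (h₀ ▸ ht _ (isTransvection_rowUnit b 0))
  obtain ⟨-, hf₁, -⟩ := IsTransvection.of_toEnd b (h₁ ▸ ht _ (isTransvection_rowUnit b 1))
  have s₀ := ht _ (isTransvection_rowUnit_add b n0.symm)
  have s₁ := ht _ (isTransvection_rowUnit_add b n1.symm)
  rw [_root_.map_add] at s₀ s₁
  change IsTransvection b ((κ (rowUnit b _)).1 + (κ (rowUnit b _)).1) at s₀ s₁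
  rw [h₀, e] at s₀
  rw [h₁, e] at s₁
  have key : ∃ c : ℂ, w = c • g := by
    rcases eq_smul_or_of_add_isTransvection b hg hf₀ s₀ with hc | ⟨c, hc⟩
    · exact hc
    rcases eq_smul_or_of_add_isTransvection b hg hf₁ s₁ with hd | ⟨d, hd⟩
    · exact hd
    have hd0 : d ≠ 0 := by
      rintro rfl
      simp [hh] at hd
    refine absurd (hinj (Subtype.ext ?_)) (rowUnit_one_ne_smul b (d⁻¹ * c))
    rw [_root_.map_smul]
    change (κ (rowUnit b 1)).1 = (d⁻¹ * c) • (κ (rowUnit b 0)).1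
    rw [h₀, h₁, ← map_smul, ← TensorProduct.tmul_smul, mul_smul, ← hc, hd, inv_smul_smul₀ hd0]
  obtain ⟨c, rfl⟩ := key
  exact ⟨c • h, by rw [e, TensorProduct.smul_tmul]⟩

include hinj ht in
/-- An embedding of `sl_∞` that maps the first two units of the zeroth row to transvections with
a common image is intertwined with the inclusion by an injective endomorphism. -/
theorem exists_intertwiner {g : V} {f₀ f₁ : Vstar b}
    (h₀ : (κ (rowUnit b 0)).1 = toEnd b (g ⊗ₜ f₀))
    (h₁ : (κ (rowUnit b 1)).1 = toEnd b (g ⊗ₜ f₁)) :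
    ∃ G : Module.End ℂ V, Function.Injective G ∧
      ∀ (x : slInf b) (v : V), (κ x).1 (G v) = G (x.1.1 v) := by
  choose f hf using exists_rowUnit_image b hinj ht h₀ h₁
  have hf' := fun n => IsTransvection.of_toEnd b (hf n ▸ ht _ (isTransvection_rowUnit b n))
  have hg : g ≠ 0 := (hf' 0).1
  have hfg : ∀ n, (f n).1 g = 0 := fun n => (hf' n).2.2
  choose w k hw hk hkw e using fun n => ht _ (isTransvection_colUnit b n)
  have key : ∀ n m, (k m).1 g * (f n).1 (w m) = if n = m then 1 else 0 := by
    intro n m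
    have h := congrArg κ (lie_lie_rowUnit_colUnit b n m)
    rw [LieHom.map_lie, LieHom.map_lie, _root_.map_smul] at h
    obtain ⟨u, hu⟩ : ∃ u, (f n).1 u ≠ 0 := by
      by_contra! hz
      exact (hf' n).2.1 (Subtype.ext (LinearMap.ext hz))
    have h' := LinearMap.congr_fun (congrArg Subtype.val h) u
    change _ = (if n = m then (-2 : ℂ) else 0) • (κ (rowUnit b n)).1 u at h'
    rw [coe_lie, coe_lie, lie_lie_apply, hf, e] at h'
    simp only [toEnd_tmul, map_smul, hfg, map_zero, zero_smul, smul_zero, zero_sub,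
      smul_smul, add_zero, ← neg_smul] at h'
    have h2 := smul_left_injective ℂ hg h'
    have h3 : ((k m).1 g * (f n).1 (w m)) * (-2 * (f n).1 u) =
        (if n = m then 1 else 0) * (-2 * (f n).1 u) := by
      split_ifs at h2 ⊢ <;> linear_combination h2
    exact mul_right_cancel₀ (mul_ne_zero (by norm_num) hu) h3
  have hkg : ∀ m, (k m).1 g ≠ 0 := fun m h => by simpa [h] using key m m
  have hkk : ∀ m, ∃ c : ℂ, k m = c • k 0 := by
    intro m
    rcases eq_or_ne m 0 with rfl | hm
    · exact ⟨1, (one_smul _ _).symm⟩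
    have s := ht _ (isTransvection_colUnit_add b hm.symm)
    rw [_root_.map_add] at s
    change IsTransvection b ((κ (colUnit b _)).1 + (κ (colUnit b _)).1) at s
    rw [e, e] at s
    -- If `w m` were a multiple of `w 0`, then `f m` would vanish on it, while `key m m` says it
    -- does not.
    refine (eq_smul_or_of_add_isTransvection b (hw 0) (hk 0) s).resolve_left ?_
    rintro ⟨c, hc⟩
    have h1 := key m m
    have h2 := key m 0
    rw [if_neg hm] at h2
    rw [hc, map_smul, (mul_eq_zero.1 h2).resolve_left (hkg 0)] at h1
    simp at h1
  -- the images of the basis vectors, and the functionals dual to them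
  let z : ℕ → V := fun m => (k m).1 g • w m
  let q : Vstar b := ((k 0).1 g)⁻¹ • k 0
  have hq : ∀ v, q.1 v = ((k 0).1 g)⁻¹ * (k 0).1 v := fun v => rfl
  have hqg : q.1 g = 1 := by rw [hq, inv_mul_cancel₀ (hkg 0)]
  have hfz : ∀ n m, (f n).1 (z m) = if n = m then 1 else 0 := fun n m => by
    simpa [z] using key n m
  have hkq : ∀ m, k m = (k m).1 g • q := by
    intro m
    obtain ⟨c, hc⟩ := hkk m
    apply Subtype.ext
    ext v
    change (k m).1 v = (k m).1 g * (((k 0).1 g)⁻¹ * (k 0).1 v)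
    rw [hc]
    change c * _ = c * (k 0).1 g * _
    field_simp [hkg 0]
  have hqz : ∀ m, q.1 (z m) = 0 := by
    intro m
    have h1 : (k m).1 (w m) = (k m).1 g * q.1 (w m) :=
      LinearMap.congr_fun (congrArg Subtype.val (hkq m)) (w m)
    rw [hkw] at h1
    simpa [z] using h1.symm
  have hy : ∀ m, (κ (colUnit b m)).1 = toEnd b (z m ⊗ₜ q) := by
    intro m
    rw [e, TensorProduct.smul_tmul, ← hkq]
  let G : Module.End ℂ V := b.constr ℂ fun n => Nat.casesOn n g z
  have hG0 : G (b 0) = g := by simp [G]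
  have hGs : ∀ n, G (b (n + 1)) = z n := fun n => by simp [G]
  have hGq : ∀ v, q.1 (G v) = b.coord 0 v := by
    have : q.1 ∘ₗ G = b.coord 0 := b.ext fun n => by
      rcases n with _ | n
      · simp [hG0, hqg]
      · simp [hGs, hqz]
    exact LinearMap.congr_fun this
  have hGf : ∀ n v, (f n).1 (G v) = b.coord (n + 1) v := by
    intro n
    have : (f n).1 ∘ₗ G = b.coord (n + 1) := b.ext fun m => by
      rcases m with _ | m
      · simp [hG0, hfg]
      · simp [hGs, hfz, Finsupp.single_apply, eq_comm]
    exact LinearMap.congr_fun this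
  refine ⟨G, ?_, ?_⟩
  · rw [← LinearMap.ker_eq_bot, LinearMap.ker_eq_bot']
    intro v hv
    refine b.ext_elem fun n => ?_
    rcases n with _ | n
    · simpa [hv] using (hGq v).symm
    · simpa [hv] using (hGf n v).symm
  -- The elements intertwined by `G` form a subalgebra, so the generators suffice.
  · let S : LieSubalgebra ℂ (slInf b) :=
      { carrier := {x | ∀ v, (κ x).1 (G v) = G (x.1.1 v)}
        add_mem' := fun {x y} hx hy v => by
          rw [_root_.map_add]
          change (κ x).1 (G v) + (κ y).1 (G v) = G (x.1.1 v + y.1.1 v)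
          rw [hx, hy, map_add]
        zero_mem' := fun v => by simp
        smul_mem' := fun c x hx v => by
          rw [_root_.map_smul]
          change c • (κ x).1 (G v) = G (c • x.1.1 v)
          rw [hx, map_smul]
        lie_mem' := fun {x y} hx hy v => by
          rw [LieHom.map_lie, coe_lie]
          change (κ x).1 ((κ y).1 (G v)) - (κ y).1 ((κ x).1 (G v)) =
            G (x.1.1 (y.1.1 v) - y.1.1 (x.1.1 v))
          rw [hx, hy, hx, hy, map_sub] }
    refine slInf_subalgebra_eq_top b S (fun n v => ?_) (fun n v => ?_)
    · change (κ (rowUnit b n)).1 (G v) = G ((rowUnit b n).1.1 v)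
      rw [rowUnit_coe, hf, toEnd_tmul, toEnd_tmul, hGf, map_smul, hG0, dualBasis_coe]
    · change (κ (colUnit b n)).1 (G v) = G ((colUnit b n).1.1 v)
      rw [colUnit_coe, hy, toEnd_tmul, toEnd_tmul, hGq, map_smul, hGs, dualBasis_coe]

/-! ### Intertwiners belong to `Gtilde` -/

/-- If `p ∈ V_*` has `p v = 1`, then pulling `p` back along `v ⊗ f` returns `f`. -/
theorem mem_Vstar_of_smulRight_mem {v : V} (hv : v ≠ 0) {f : Module.Dual ℂ V}
    (h : f.smulRight v ∈ glM b) : f ∈ Vstar b := by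
  obtain ⟨p, hp⟩ := exists_Vstar_one b hv
  convert h p.1 p.2
  ext u
  simp [hp]

theorem exists_ne_zero_apply_eq_zero (b : Module.Basis ℕ ℂ V) (f : Module.Dual ℂ V) :
    ∃ v, v ≠ 0 ∧ f v = 0 := by
  by_cases h0 : f (b 0) = 0
  · exact ⟨b 0, b.ne_zero 0, h0⟩
  · refine ⟨f (b 1) • b 0 - f (b 0) • b 1, fun hz => h0 ?_, by simp [mul_comm]⟩
    simpa using congrArg (b.coord 1) hz

variable (sκ : ∀ x : slInf b, ∃ y, κ y = x)

include sκ in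
/-- The intertwiner of an embedding of `sl_∞` onto itself lies in `Gtilde`. -/
theorem exists_conjAut_of_intertwiner {G : Module.End ℂ V} (hG : Function.Injective G)
    (h : ∀ (x : slInf b) (v : V), (κ x).1 (G v) = G (x.1.1 v)) :
    ∃ g : Gtilde b, ∀ x : slInf b, κ x = conjAut b g x := by
  have hb0 : G (b 0) ≠ 0 := fun h0 => b.ne_zero 0 (hG (h0.trans G.map_zero.symm))
  have hsurj : Function.Surjective G := by
    intro v
    by_cases hv : LinearIndependent ℂ ![G (b 0), v]
    -- Here `v ⊗ p` lies in `sl_∞`, so it is some `κ y`, and it sends `G e_0` to `v`; hence `v = G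
    -- (y e_0)`.
    · obtain ⟨p, hp, hpv⟩ := exists_Vstar_pair b hv 1 0
      obtain ⟨y, hy⟩ := sκ (toSl b (v ⊗ₜ p))
      refine ⟨y.1.1 (b 0), ?_⟩
      rw [← h, hy, toSl_coe_of_pairing b (t := v ⊗ₜ p) hpv, toEnd_tmul, hp, one_smul]
    · rw [LinearIndependent.pair_iff' hb0] at hv
      push Not at hv
      obtain ⟨c, rfl⟩ := hv
      exact ⟨c • b 0, map_smul _ _ _⟩
  let g : V ≃ₗ[ℂ] V := LinearEquiv.ofBijective G ⟨hG, hsurj⟩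
  have hg : ∀ v, g v = G v := fun v => rfl
  have hconj : ∀ (x : slInf b) v, (κ x).1 v = g (x.1.1 (g.symm v)) := by
    intro x v
    rw [hg, ← h, ← hg, g.apply_symm_apply]
  have h1 : ∀ f ∈ Vstar b, g.toLinearMap.dualMap f ∈ Vstar b := by
    intro f hf
    obtain ⟨v, hv, hfv⟩ := exists_ne_zero_apply_eq_zero b f
    obtain ⟨y, hy⟩ := sκ (toSl b (v ⊗ₜ ⟨f, hf⟩))
    -- Conjugating `v ⊗ f` by `g⁻¹` gives `g⁻¹ v ⊗ g^* f`, which is `y` and so lies in the Mackey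
    -- algebra.
    refine mem_Vstar_of_smulRight_mem b (v := g.symm v) (by simpa using hv) ?_
    convert y.1.2
    ext u
    apply g.injective
    rw [hg (y.1.1 u), ← h, hy, toSl_coe_of_pairing b (t := v ⊗ₜ ⟨f, hf⟩) hfv, toEnd_tmul]
    change g (f (g u) • g.symm v) = f (g u) • v
    rw [map_smul, g.apply_symm_apply]
  have h2 : ∀ f ∈ Vstar b, g.symm.toLinearMap.dualMap f ∈ Vstar b := by
    intro f hf
    obtain ⟨v, hv, hfv⟩ := exists_ne_zero_apply_eq_zero b f
    refine mem_Vstar_of_smulRight_mem b (v := g v) (by simpa using hv) ?_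
    convert (κ (toSl b (v ⊗ₜ ⟨f, hf⟩))).2
    ext u
    rw [hconj, toSl_coe_of_pairing b (t := v ⊗ₜ ⟨f, hf⟩) hfv, toEnd_tmul]
    simp
  have hmem : g ∈ Gtilde b := by
    change (Vstar b).map g.toLinearMap.dualMap = Vstar b
    apply le_antisymm
    · rintro _ ⟨f, hf, rfl⟩
      exact h1 f hf
    · intro f hf
      refine ⟨_, h2 f hf, ?_⟩
      ext v
      simp
  exact ⟨⟨g, hmem⟩, fun x => Subtype.ext (LinearMap.ext (hconj x))⟩

/-- `τ` exchanges vector and functional, turning a common functional into a common vector. -/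
theorem tau_toEnd {φ : glM b} {v : V} {f : Vstar b} (h : φ.1 = toEnd b (v ⊗ₜ f)) :
    (tau b φ).1 = toEnd b ((-(eps b).symm f) ⊗ₜ eps b v) := by
  refine b.ext fun j => b.repr.injective (Finsupp.ext fun i => ?_)
  change b.repr (tauFun b φ (b j)) i = _
  rw [tauFun_entry, h, toEnd_tmul, toEnd_tmul, eps_apply_basis, map_smul, map_smul, map_neg]
  have : b.repr ((eps b).symm f) i = f.1 (b i) := by
    rw [← eps_apply_basis, LinearEquiv.apply_symm_apply]
  simp [this, mul_comm]

include hinj sκ in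
/-- An embedding of `sl_∞` onto itself is conjugation, up to the involution `τ`. -/
theorem exists_conjAut :
    (∃ g : Gtilde b, ∀ x : slInf b, κ x = conjAut b g x) ∨
      ∃ g : Gtilde b, ∀ x : slInf b, tau b (κ x) = conjAut b g x := by
  have ht : ∀ κ : slInf b →ₗ⁅ℂ⁆ glM b, Function.Injective κ →
      (∀ x : slInf b, ∃ y, κ y = x) →
      ∀ x : slInf b, IsTransvection b x.1.1 → IsTransvection b (κ x).1 :=
    fun κ hκ sκ x => IsTransvection.map b (ι := (slInf b).incl) Subtype.val_injective hκ
      (fun x => ⟨x, rfl⟩) sκ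
  have ht₁ := ht κ hinj sκ
  obtain ⟨v, f, hv, hf, -, e₀⟩ := ht₁ _ (isTransvection_rowUnit b 0)
  obtain ⟨w, h, hw, hh, -, e₁⟩ := ht₁ _ (isTransvection_rowUnit b 1)
  have s := ht₁ _ (isTransvection_rowUnit_add b zero_ne_one)
  rw [_root_.map_add] at s
  change IsTransvection b ((κ (rowUnit b _)).1 + (κ (rowUnit b _)).1) at s
  rw [e₀, e₁] at s
  rcases eq_smul_or_of_add_isTransvection b hv hf s with ⟨c, rfl⟩ | ⟨c, rfl⟩
  · left
    rw [TensorProduct.smul_tmul] at e₁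
    obtain ⟨G, hG, hGκ⟩ := exists_intertwiner b hinj ht₁ e₀ e₁
    exact exists_conjAut_of_intertwiner b sκ hG hGκ
  · right
    let κ' : slInf b →ₗ⁅ℂ⁆ glM b := (tau b).toLieHom.comp κ
    have hinj' : Function.Injective κ' := (tau b).injective.comp hinj
    have sκ' : ∀ x : slInf b, ∃ y, κ' y = x := by
      intro x
      obtain ⟨y, hy⟩ := aut_surjOn_slInf b (tau b) x
      obtain ⟨z, hz⟩ := sκ y
      exact ⟨z, (congrArg (tau b) hz).trans hy⟩
    have e₀' := tau_toEnd b e₀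
    have e₁' := tau_toEnd b e₁
    rw [map_smul, ← smul_neg, TensorProduct.smul_tmul] at e₁'
    obtain ⟨G, hG, hGκ⟩ := exists_intertwiner b (κ := κ') hinj' (ht κ' hinj' sκ') e₀' e₁'
    exact exists_conjAut_of_intertwiner b (κ := κ') sκ' hG hGκ

/-! ### The automorphism group -/

theorem tau_mul_tau : tau b * tau b = 1 :=
  LieEquiv.ext fun φ => Subtype.ext (tauFun_tauFun b φ)

theorem mem_G0_or (Φ : glM b ≃ₗ⁅ℂ⁆ glM b) : Φ ∈ G0 b ∨ tau b * Φ ∈ G0 b := by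
  have := exists_conjAut b (κ := Φ.toLieHom.comp (slInf b).incl)
    (Φ.injective.comp Subtype.val_injective) (aut_surjOn_slInf b Φ)
  rcases this with ⟨g, hg⟩ | ⟨g, hg⟩
  · exact Or.inl ⟨g, (aut_ext b hg).symm⟩
  · exact Or.inr ⟨g, (aut_ext b hg).symm⟩

/-- Conjugation fixes the identity of `V`, whereas `τ` negates it. -/
theorem tau_notMem_G0 : tau b ∉ G0 b := by
  rintro ⟨g, hg⟩
  let I : glM b := ⟨LinearMap.id, fun f hf => hf⟩
  have h0 : conjAut b g I = I := Subtype.ext (LinearMap.ext fun v => g.1.apply_symm_apply v)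
  have h1 : tau b I = I := (congrArg (fun Φ : glM b ≃ₗ⁅ℂ⁆ glM b => Φ I) hg).symm.trans h0
  have h2 := tauFun_entry b I 0 0
  rw [show tauFun b I = I.1 from congrArg Subtype.val h1] at h2
  norm_num [I] at h2

/-- The group `{Id, τ}`. -/
def tauSubgroup : Subgroup (glM b ≃ₗ⁅ℂ⁆ glM b) where
  carrier := {1, tau b}
  mul_mem' := by
    rintro _ _ (rfl | rfl) (rfl | rfl)
    · exact Or.inl (one_mul _)
    · exact Or.inr (one_mul _)
    · exact Or.inr (mul_one _)
    · exact Or.inl (tau_mul_tau b)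
  one_mem' := Or.inl rfl
  inv_mem' := by
    rintro _ (rfl | rfl)
    · exact Or.inl inv_one
    · exact Or.inr (inv_eq_of_mul_eq_one_left (tau_mul_tau b))

theorem tau_ne_one : tau b ≠ 1 := fun h => tau_notMem_G0 b (h ▸ one_mem _)

theorem card_tauSubgroup : Nat.card (tauSubgroup b) = 2 := by
  change Nat.card ({1, tau b} : Set (glM b ≃ₗ⁅ℂ⁆ glM b)) = 2
  rw [Nat.card_coe_set_eq, Set.ncard_pair (tau_ne_one b).symm]

theorem isComplement_tauSubgroup : Subgroup.IsComplement' (G0 b) (tauSubgroup b) := by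
  apply Subgroup.isComplement'_of_disjoint_and_mul_eq_univ
  · rw [Subgroup.disjoint_def]
    rintro x hx (rfl | rfl)
    · rfl
    · exact absurd hx (tau_notMem_G0 b)
  · refine Set.eq_univ_of_forall fun Φ => ?_
    -- Using `Φ⁻¹` puts the factor `τ` on the right of the product.
    rcases mem_G0_or b Φ⁻¹ with h | h
    · exact ⟨Φ, by simpa using h, 1, Or.inl rfl, mul_one _⟩
    · refine ⟨(tau b * Φ⁻¹)⁻¹, inv_mem h, tau b, Or.inr rfl, ?_⟩
      simp

theorem G0_normal : (G0 b).Normal := by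
  apply Subgroup.normal_of_index_eq_two
  rw [(isComplement_tauSubgroup b).symm.index_eq_card, card_tauSubgroup]

theorem existsUnique_extension (σ : slInf b ≃ₗ⁅ℂ⁆ slInf b) :
    ∃! Φ : glM b ≃ₗ⁅ℂ⁆ glM b, ∀ x : slInf b, Φ (x : glM b) = (σ x : glM b) := by
  have := exists_conjAut b (κ := (slInf b).incl.comp σ.toLieHom)
    (Subtype.val_injective.comp σ.injective)
    (fun x => ⟨σ.symm x, congrArg Subtype.val (σ.apply_symm_apply x)⟩)
  have hex : ∃ Φ : glM b ≃ₗ⁅ℂ⁆ glM b, ∀ x : slInf b, Φ (x : glM b) = (σ x : glM b) := by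
    rcases this with ⟨g, hg⟩ | ⟨g, hg⟩
    · exact ⟨conjAut b g, fun x => (hg x).symm⟩
    -- Since `τ² = 1`, `τ ∘ σ = conjAut g` on `sl_∞` gives `σ = τ ∘ conjAut g`.
    · refine ⟨tau b * conjAut b g, fun x => ?_⟩
      exact (congrArg (tau b) (hg x)).symm.trans (Subtype.ext (tauFun_tauFun b _))
  obtain ⟨Φ, hΦ⟩ := hex
  exact ⟨Φ, hΦ, fun Ψ hΨ => aut_ext b fun x => (hΨ x).trans (hΦ x).symm⟩

theorem mat_tau (φ : glM b) : mat b (tau b φ) = -(mat b φ).transpose := by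
  ext i j
  exact tauFun_entry b φ i j

end MackeyLie

end

theorem mainTheorem1 {V : Type*} [AddCommGroup V] [Module ℂ V] (b : Module.Basis ℕ ℂ V) :
    -- `τ` is the involution `A ↦ -Aᵗ`
    (∀ φ : MackeyLie.glM b,
      MackeyLie.mat b (MackeyLie.tau b φ) = -(MackeyLie.mat b φ).transpose) ∧
    -- the automorphism group is the internal semidirect product of `G0` and `{Id, τ}`
    (∃ T : Subgroup (MackeyLie.glM b ≃ₗ⁅ℂ⁆ MackeyLie.glM b),
      (T : Set (MackeyLie.glM b ≃ₗ⁅ℂ⁆ MackeyLie.glM b)) = {1, MackeyLie.tau b} ∧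
      Nat.card T = 2 ∧
      (MackeyLie.G0 b).Normal ∧
      Subgroup.IsComplement' (MackeyLie.G0 b) T) ∧
    -- unique extension of automorphisms of `sl_∞`
    (∀ σ : MackeyLie.slInf b ≃ₗ⁅ℂ⁆ MackeyLie.slInf b,
      ∃! Φ : MackeyLie.glM b ≃ₗ⁅ℂ⁆ MackeyLie.glM b,
        ∀ x : MackeyLie.slInf b, Φ (x : MackeyLie.glM b) = (σ x : MackeyLie.glM b)) := by
  refine ⟨MackeyLie.mat_tau b, ⟨MackeyLie.tauSubgroup b, rfl, MackeyLie.card_tauSubgroup b,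
    MackeyLie.G0_normal b, MackeyLie.isComplement_tauSubgroup b⟩,
    MackeyLie.existsUnique_extension b⟩
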